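/- **Proposition.** Let $d,m\in\mathbb N$, let $\Psi_0\in\mathbb R^{m\times(d+m)}$, $\Psi_1\in\mathbb R^{d\times(d+m)}$, let $\delta=\mathrm{diag}(\delta^1,\dots,\delta^d)$ with all $\delta^i\neq 0$, and let $\gamma<0$ and $T\in\mathbb R$. Put $$\Sigma_0=\Psi_0\Psi_0^\top,\quad \Sigma_1=\Psi_1\Psi_1^\top,\quad \beta=\Psi_1\Psi_0^\top\Sigma_0^{-1},\quad \Sigma_2=\Sigma_1-\Psi_1\Psi_0^\top\beta^\top,$$ $$\Sigma_3=\Sigma_1-\Psi_1\Psi_0^\top\beta^\top-\beta\Psi_0\Psi_1^\top+\beta\Sigma_0\beta^\top,\quad \Sigma_c=\Sigma_1^{-1}\beta(\beta^\top\Sigma_1^{-1}\beta)^{-1}\beta^\top\Sigma_1^{-1},$$ where $\Sigma_0,\Sigma_1,\Sigma_3$ are assumed symmetric positive definite ($\Sigma_0,\Sigma_1$ are the diffusion matrices of the factors and of the stocks, $\Sigma_3$ that of the co-integrated spreads, and $\Sigma_c$ arises from the market-neutral constraint $\pi^\top\beta=0$). Define $$Q_c=\tfrac{2\gamma}{1-\gamma}\Sigma_2^\top(\Sigma_1^{-1}-\Sigma_c)\Sigma_2+2\Sigma_3,\quad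 A_c=-\tfrac{\gamma}{1-\gamma}\Sigma_2^\top(\Sigma_1^{-1}-\Sigma_c)\delta-\delta,\quad P_c=\tfrac{\gamma}{2(1-\gamma)}\delta(\Sigma_1^{-1}-\Sigma_c)\delta .$$ Assume $$\mathrm{rank}\Big(\big(\delta-\beta(\beta^\top\beta)^{-1}\beta^\top\delta\big)\beta\Big)=m\quad\text{and}\quad \mathrm{rank}(\beta^\top\beta)=m .$$ Then $Q_c$ is symmetric positive definite and $-P_c$ is symmetric positive semi-definite. There are matrices $B_c,N_c,E_c\in\mathbb R^{d\times d}$ with $N_c$ symmetric positive definite such that $Q_c=B_cN_c^{-1}B_c^\top$ and $-P_c=E_c^\top E_c$; the pair $(A_c,B_c)$ is stabilisable (for some real matrix $M$ all eigenvalues of $A_c-B_cM$ have negative real part); and the pair $(E_c,A_c)$ is observable, that is, the controllability matrix $[E_c^\top,\;A_c^\top E_c^\top,\;\dots,\;(A_c^\top)^{d-1}E_c^\top]$ has rank $d$. Moreover the matrix Riccati equation $$C'(t)=-C(t)Q_cC(t)-C(t)A_c-A_c^\top C(t)-P_c\quad(t\le T),\qquad C(T)=0,$$ has exactly one solution on $(-\infty,T]$;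 this solution is symmetric negative semi-definite for every $t\le T$ and bounded on $(-\infty,T]$, and there is a unique limit $\bar C=\lim_{t\to-\infty}C(t)$. -/

import Mathlib

open Matrix Filter Topology Set

noncomputable section

/-- Coefficients of the co-integration model with `d` stocks, `m` factors and a
`(d + m)`-dimensional Brownian motion, together with the exponent of the power utility
`w ↦ w ^ γ / γ`.  Only data; all assumptions are stated in the theorem. -/
structure CointModel (d m : ℕ) where
  /-- Volatility matrix of the factors. -/
  Psi0 : Matrix (Fin m) (Fin (d + m)) ℝ
  /-- Volatility matrix of the stocks. -/
  Psi1 : Matrix (Fin d) (Fin (d + m)) ℝ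
  /-- Mean reversion speeds of the co-integrated spreads. -/
  speed : Fin d → ℝ
  /-- Risk aversion coefficient. -/
  gam : ℝ

namespace CointModel

variable {d m : ℕ} (p : CointModel d m)

/-- `δ = diag (δ¹, …, δᵈ)`. -/
def delta : Matrix (Fin d) (Fin d) ℝ := Matrix.diagonal p.speed

/-- `Σ₀ = Ψ₀ Ψ₀ᵀ`. -/
def Sigma0 : Matrix (Fin m) (Fin m) ℝ := p.Psi0 * p.Psi0ᵀ

/-- `Σ₁ = Ψ₁ Ψ₁ᵀ`. -/
def Sigma1 : Matrix (Fin d) (Fin d) ℝ := p.Psi1 * p.Psi1ᵀ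

/-- Factor loadings `β = Ψ₁ Ψ₀ᵀ Σ₀⁻¹`. -/
def beta : Matrix (Fin d) (Fin m) ℝ := p.Psi1 * p.Psi0ᵀ * p.Sigma0⁻¹

/-- `Σ₂ = Σ₁ - Ψ₁ Ψ₀ᵀ βᵀ`. -/
def Sigma2 : Matrix (Fin d) (Fin d) ℝ := p.Sigma1 - p.Psi1 * p.Psi0ᵀ * p.betaᵀ

/-- `Σ₃ = Σ₁ - Ψ₁ Ψ₀ᵀ βᵀ - β Ψ₀ Ψ₁ᵀ + β Σ₀ βᵀ`, the diffusion matrix of the spreads. -/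
def Sigma3 : Matrix (Fin d) (Fin d) ℝ :=
  p.Sigma1 - p.Psi1 * p.Psi0ᵀ * p.betaᵀ - p.beta * p.Psi0 * p.Psi1ᵀ
    + p.beta * p.Sigma0 * p.betaᵀ

/-- `Σ_c = Σ₁⁻¹ β (βᵀ Σ₁⁻¹ β)⁻¹ βᵀ Σ₁⁻¹`, produced by the market-neutral constraint `πᵀ β = 0`. -/
def SigmaC : Matrix (Fin d) (Fin d) ℝ :=
  p.Sigma1⁻¹ * p.beta * (p.betaᵀ * p.Sigma1⁻¹ * p.beta)⁻¹ * p.betaᵀ * p.Sigma1⁻¹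

/-- `Q_c = 2γ/(1-γ) Σ₂ᵀ (Σ₁⁻¹ - Σ_c) Σ₂ + 2 Σ₃`. -/
def Qc : Matrix (Fin d) (Fin d) ℝ :=
  (2 * p.gam / (1 - p.gam)) • (p.Sigma2ᵀ * (p.Sigma1⁻¹ - p.SigmaC) * p.Sigma2)
    + (2 : ℝ) • p.Sigma3

/-- `A_c = -γ/(1-γ) Σ₂ᵀ (Σ₁⁻¹ - Σ_c) δ - δ`. -/
def Ac : Matrix (Fin d) (Fin d) ℝ :=
  -((p.gam / (1 - p.gam)) • (p.Sigma2ᵀ * (p.Sigma1⁻¹ - p.SigmaC) * p.delta)) - p.delta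

/-- `P_c = γ/(2(1-γ)) δ (Σ₁⁻¹ - Σ_c) δ`. -/
def Pc : Matrix (Fin d) (Fin d) ℝ :=
  (p.gam / (2 * (1 - p.gam))) • (p.delta * (p.Sigma1⁻¹ - p.SigmaC) * p.delta)

/-- `C` solves `C' = -C Q_c C - C A_c - A_cᵀ C - P_c` on `(-∞, T]` with `C(T) = 0`
(one-sided derivative at `T`; the derivative of a matrix function is taken entrywise).
Values of `C` beyond `T` play no role. -/
def IsRiccatiSolution (T : ℝ) (C : ℝ → Matrix (Fin d) (Fin d) ℝ) : Prop :=
  (∀ t ≤ T, ∀ i j, HasDerivWithinAt (fun s => C s i j)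
      ((-(C t * p.Qc * C t) - C t * p.Ac - p.Acᵀ * C t - p.Pc) i j) (Iic T) t) ∧
    C T = 0

end CointModel

/-- The controllability matrix `[B, A B, …, A ^ (n - 1) B]`; column `(k, l)` is the `l`-th column
of the block `A ^ k B`. -/
def controllabilityMatrix {n q : ℕ} (A : Matrix (Fin n) (Fin n) ℝ) (B : Matrix (Fin n) (Fin q) ℝ) :
    Matrix (Fin n) (Fin n × Fin q) ℝ :=
  Matrix.of fun i kl => (A ^ (kl.1 : ℕ) * B) i kl.2

/-- `(A, B)` is controllable if its controllability matrix has rank `n`. -/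
def IsControllable {n q : ℕ} (A : Matrix (Fin n) (Fin n) ℝ) (B : Matrix (Fin n) (Fin q) ℝ) : Prop :=
  (controllabilityMatrix A B).rank = n

/-- `(E, A)` is observable if `(Aᵀ, Eᵀ)` is controllable. -/
def IsObservable {n q : ℕ} (E : Matrix (Fin q) (Fin n) ℝ) (A : Matrix (Fin n) (Fin n) ℝ) : Prop :=
  IsControllable Aᵀ Eᵀ

/-- `(A, B)` is stabilisable if, for some real `M`, all complex eigenvalues of `A - B M` have
negative real part. -/
def IsStabilisable {n q : ℕ} (A : Matrix (Fin n) (Fin n) ℝ) (B : Matrix (Fin n) (Fin q) ℝ) : Prop :=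
  ∃ M : Matrix (Fin q) (Fin n) ℝ,
    ∀ z ∈ spectrum ℂ ((A - B * M).map (algebraMap ℝ ℂ)), z.re < 0

end

/-! ### Injectivity from rank, and the Kalman criterion -/

section Rank

/-! Since `Ψ₁ Ψ₀ᵀ = β Σ₀`, the matrices `Σ₂` and `Σ₃` coincide and equal `Σ₁ - β Σ₀ βᵀ`. The
market-neutral matrix `R = Σ₁⁻¹ - Σ_c` is positive semidefinite with kernel the range of `β`. This
gives the signs of `Q_c` and `P_c`. If `E x = 0` then `R δ x = 0`, so `A_c x = -δ x`; if also `E A_c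
x = 0`, the rank condition on `δ` forces `x = 0`.

For the Riccati equation put `P = -P_c` and reverse time: `X(s) = -C(T - s)` solves `X' = P + Aᵀ X +
X A - X Q X`, `X(0) = 0`. It is linearised as `X = V U⁻¹`, with `(U, V)` a solution of a linear
Hamiltonian system. `U` stays invertible (`isUnit_left`), and conservation of energy reads `Uᵀ X' U
= P`, so `X` increases from `0`. Positivity of `X'` with `Q` positive definite bounds `X` uniformly
in time (`exists_quotient_bound`), and a bounded monotone symmetric family converges. -/

theorem mulVec_injective_of_rank_eq {n m : ℕ} {M : Matrix (Fin n) (Fin m) ℝ} (h : M.rank = m) :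
    Function.Injective M.mulVec := by
  have h1 := M.mulVecLin.finrank_range_add_finrank_ker
  have h2 : Module.finrank ℝ (LinearMap.range M.mulVecLin) = m := h
  rw [h2] at h1
  simp only [Module.finrank_fintype_fun_eq_card, Fintype.card_fin, Nat.add_eq_left] at h1
  exact LinearMap.ker_eq_bot.mp (Submodule.finrank_eq_zero.mp h1)

/-- Kalman criterion: `(E, A)` is observable if only `0` is annihilated by all `E * A ^ k`, `k < n`. -/
theorem isObservable_of_forall_mulVec {n q : ℕ} {E : Matrix (Fin q) (Fin n) ℝ}
    {A : Matrix (Fin n) (Fin n) ℝ}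
    (h : ∀ x, (∀ k < n, (E * A ^ k) *ᵥ x = 0) → x = 0) : IsObservable E A := by
  -- A vector in the left kernel of the controllability matrix is one killed by every `E * A ^ k`,
  -- so the rows are independent.
  have key : Function.Injective (controllabilityMatrix Aᵀ Eᵀ).vecMul := by
    intro x y hxy
    rw [← sub_eq_zero]
    refine h _ fun k hk => ?_
    have h0 : (x - y) ᵥ* controllabilityMatrix Aᵀ Eᵀ = 0 := by
      rw [sub_vecMul]
      exact sub_eq_zero.mpr hxy
    ext l
    have h1 := congrFun h0 (⟨k, hk⟩, l)
    rw [mulVec, dotProduct_comm]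
    have h2 : E * A ^ k = (Aᵀ ^ k * Eᵀ)ᵀ := by
      rw [transpose_mul, transpose_transpose, transpose_pow, transpose_transpose]
    rw [h2]
    exact h1
  have := LinearIndependent.rank_matrix (Matrix.vecMul_injective_iff.mp key)
  simpa [IsObservable, IsControllable] using this

end Rank

/-! ### Algebra of the coefficients: signs, observability, stabilisability -/

namespace CointModel

variable {d m : ℕ} (p : CointModel d m)

theorem Psi1_mul_Psi0_transpose (h0 : p.Sigma0.PosDef) :
    p.Psi1 * p.Psi0ᵀ = p.beta * p.Sigma0 := by
  rw [beta, Matrix.mul_assoc, Matrix.nonsing_inv_mul _ (Matrix.isUnit_iff_isUnit_det _ |>.mp h0.isUnit),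
    Matrix.mul_one]

theorem Sigma0_transpose : p.Sigma0ᵀ = p.Sigma0 := by simp [Sigma0]

theorem Sigma1_transpose : p.Sigma1ᵀ = p.Sigma1 := by simp [Sigma1]

theorem Sigma2_eq (h0 : p.Sigma0.PosDef) :
    p.Sigma2 = p.Sigma1 - p.beta * p.Sigma0 * p.betaᵀ := by
  rw [Sigma2, p.Psi1_mul_Psi0_transpose h0]

theorem Sigma3_eq_Sigma2 (h0 : p.Sigma0.PosDef) : p.Sigma3 = p.Sigma2 := by
  have h : p.Psi0 * p.Psi1ᵀ = p.Sigma0 * p.betaᵀ := by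
    rw [← transpose_transpose p.Psi0, ← transpose_mul, p.Psi1_mul_Psi0_transpose h0, transpose_mul,
      Sigma0_transpose]
  rw [Sigma3, p.Sigma2_eq h0, p.Psi1_mul_Psi0_transpose h0, Matrix.mul_assoc p.beta p.Psi0, h,
    ← Matrix.mul_assoc]
  abel

theorem Sigma2_transpose (h0 : p.Sigma0.PosDef) : p.Sigma2ᵀ = p.Sigma2 := by
  rw [p.Sigma2_eq h0]
  simp [Matrix.mul_assoc, Sigma0_transpose, Sigma1_transpose]

theorem Sigma1_inv_transpose : (p.Sigma1⁻¹)ᵀ = p.Sigma1⁻¹ := by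
  rw [transpose_nonsing_inv, Sigma1_transpose]

theorem gram_posDef (h1 : p.Sigma1.PosDef) (hb : Function.Injective p.beta.mulVec) :
    (p.betaᵀ * p.Sigma1⁻¹ * p.beta).PosDef := by
  simpa using h1.inv.conjTranspose_mul_mul_same hb

theorem SigmaC_posSemidef (h1 : p.Sigma1.PosDef) (hb : Function.Injective p.beta.mulVec) :
    p.SigmaC.PosSemidef := by
  have := (p.gram_posDef h1 hb).inv.posSemidef.mul_mul_conjTranspose_same (p.Sigma1⁻¹ * p.beta)
  simpa [SigmaC, Matrix.mul_assoc, transpose_nonsing_inv, Sigma1_transpose] using this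

theorem SigmaC_mul_beta (h1 : p.Sigma1.PosDef) (hb : Function.Injective p.beta.mulVec) :
    p.SigmaC * p.beta = p.Sigma1⁻¹ * p.beta := by
  have hG := Matrix.isUnit_iff_isUnit_det _ |>.mp (p.gram_posDef h1 hb).isUnit
  have := Matrix.nonsing_inv_mul _ hG
  calc p.SigmaC * p.beta = p.Sigma1⁻¹ * p.beta *
      ((p.betaᵀ * p.Sigma1⁻¹ * p.beta)⁻¹ * (p.betaᵀ * p.Sigma1⁻¹ * p.beta)) := by
        simp only [SigmaC, Matrix.mul_assoc]
    _ = _ := by rw [this, Matrix.mul_one]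

/-- The matrix `Σ₁⁻¹ - Σ_c` of the market-neutral problem. -/
noncomputable def neutral : Matrix (Fin d) (Fin d) ℝ := p.Sigma1⁻¹ - p.SigmaC

theorem neutral_mul_beta (h1 : p.Sigma1.PosDef) (hb : Function.Injective p.beta.mulVec) :
    p.neutral * p.beta = 0 := by
  rw [neutral, Matrix.sub_mul, p.SigmaC_mul_beta h1 hb, sub_self]

theorem neutral_isHermitian (h1 : p.Sigma1.PosDef) (hb : Function.Injective p.beta.mulVec) :
    p.neutral.IsHermitian :=
  h1.inv.isHermitian.sub (p.SigmaC_posSemidef h1 hb).isHermitian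

/-- With `R` for `neutral`: `Σ₁ R = 1 - β (⋯)` and `R β = 0`, so `R = R Σ₁ R` is a congruence of
`Σ₁`. -/
theorem neutral_posSemidef (h1 : p.Sigma1.PosDef) (hb : Function.Injective p.beta.mulVec) :
    p.neutral.PosSemidef := by
  have hR := p.neutral_isHermitian h1 hb
  have hu := Matrix.isUnit_iff_isUnit_det _ |>.mp h1.isUnit
  have e : p.neutral * p.Sigma1 * p.neutral = p.neutral := by
    have h2 : p.Sigma1 * p.neutral =
        1 - p.beta * ((p.betaᵀ * p.Sigma1⁻¹ * p.beta)⁻¹ * p.betaᵀ * p.Sigma1⁻¹) := by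
      rw [neutral, Matrix.mul_sub, Matrix.mul_nonsing_inv _ hu, SigmaC]
      simp only [Matrix.mul_assoc]
      rw [Matrix.mul_nonsing_inv_cancel_left _ _ hu]
    rw [Matrix.mul_assoc, h2, Matrix.mul_sub, ← Matrix.mul_assoc, p.neutral_mul_beta h1 hb]
    simp
  have := h1.posSemidef.conjTranspose_mul_mul_same p.neutral
  rwa [hR.eq, e] at this

/-- The kernel of `Σ₁⁻¹ - Σ_c` is the range of `β`. -/
theorem exists_eq_beta_mulVec (h1 : p.Sigma1.PosDef) {y : Fin d → ℝ}
    (hy : p.neutral *ᵥ y = 0) : ∃ u, y = p.beta *ᵥ u := by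
  have hu := Matrix.isUnit_iff_isUnit_det _ |>.mp h1.isUnit
  -- Multiplying `Σ₁⁻¹ y = Σ_c y` by `Σ₁` exhibits `y` as `β` times this vector.
  refine ⟨((p.betaᵀ * p.Sigma1⁻¹ * p.beta)⁻¹ * p.betaᵀ * p.Sigma1⁻¹) *ᵥ y, ?_⟩
  have h2 : p.Sigma1⁻¹ *ᵥ y = p.SigmaC *ᵥ y := by
    rw [neutral, sub_mulVec] at hy
    exact sub_eq_zero.mp hy
  calc y = (p.Sigma1 * p.Sigma1⁻¹) *ᵥ y := by rw [Matrix.mul_nonsing_inv _ hu, one_mulVec]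
    _ = p.Sigma1 *ᵥ (p.SigmaC *ᵥ y) := by rw [← mulVec_mulVec, h2]
    _ = _ := by
      rw [mulVec_mulVec, mulVec_mulVec, SigmaC]
      simp only [Matrix.mul_assoc]
      rw [Matrix.mul_nonsing_inv_cancel_left _ _ hu]

/-- With `K = Σ₁⁻¹ Σ₂`, the matrix equals `(1 - K)ᵀ Σ₂ (1 - K) + Kᵀ (Σ₁ - Σ₂) K`, and `Σ₁ - Σ₂ = β
Σ₀ βᵀ`. -/
theorem Sigma2_sub_posSemidef (h0 : p.Sigma0.PosDef) (h1 : p.Sigma1.PosDef)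
    (h2 : p.Sigma2.PosDef) : (p.Sigma2 - p.Sigma2 * p.Sigma1⁻¹ * p.Sigma2).PosSemidef := by
  have hu := Matrix.isUnit_iff_isUnit_det _ |>.mp h1.isUnit
  have a := h2.posSemidef.conjTranspose_mul_mul_same (1 - p.Sigma1⁻¹ * p.Sigma2)
  have b := (h0.posSemidef.mul_mul_conjTranspose_same p.beta).conjTranspose_mul_mul_same
    (p.Sigma1⁻¹ * p.Sigma2)
  have c : p.beta * p.Sigma0 * p.betaᴴ = p.Sigma1 - p.Sigma2 := by
    rw [p.Sigma2_eq h0, conjTranspose_eq_transpose_of_trivial]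
    abel
  rw [c] at b
  convert a.add b using 1
  simp only [conjTranspose_eq_transpose_of_trivial, transpose_sub, transpose_mul, transpose_one,
    p.Sigma2_transpose h0, p.Sigma1_inv_transpose]
  have e : p.Sigma2 * p.Sigma1⁻¹ * p.Sigma1 = p.Sigma2 := by
    rw [Matrix.mul_assoc, Matrix.nonsing_inv_mul _ hu, Matrix.mul_one]
  rw [Matrix.mul_sub (p.Sigma2 * p.Sigma1⁻¹), e]
  noncomm_ring

theorem Qc_posDef (h0 : p.Sigma0.PosDef) (h1 : p.Sigma1.PosDef) (h3 : p.Sigma3.PosDef)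
    (hgam : p.gam < 0) (hb : Function.Injective p.beta.mulVec) : p.Qc.PosDef := by
  have h2 : p.Sigma2.PosDef := p.Sigma3_eq_Sigma2 h0 ▸ h3
  have hk : 0 < 1 - p.gam := by linarith
  -- The term `2 Σ₂` is split by `2 = 2/(1-γ) - 2γ/(1-γ)`; the second share absorbs the negative
  -- term `Σ₂ Σ₁⁻¹ Σ₂`.
  have e : p.Qc = (2 / (1 - p.gam)) • p.Sigma2 +
      ((-2 * p.gam / (1 - p.gam)) • (p.Sigma2 - p.Sigma2 * p.Sigma1⁻¹ * p.Sigma2) +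
        (-2 * p.gam / (1 - p.gam)) • (p.Sigma2ᴴ * p.SigmaC * p.Sigma2)) := by
    rw [Qc, p.Sigma3_eq_Sigma2 h0, conjTranspose_eq_transpose_of_trivial, p.Sigma2_transpose h0,
      Matrix.mul_sub, Matrix.sub_mul]
    ext i j
    simp only [Matrix.add_apply, Matrix.smul_apply, Matrix.sub_apply, smul_eq_mul]
    field_simp
    ring
  rw [e]
  have hc : 0 ≤ -2 * p.gam / (1 - p.gam) := by
    apply div_nonneg <;> linarith
  exact (h2.smul (by positivity)).add_posSemidef
    (((p.Sigma2_sub_posSemidef h0 h1 h2).smul hc).add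
      (((p.SigmaC_posSemidef h1 hb).conjTranspose_mul_mul_same _).smul hc))

theorem delta_transpose : p.deltaᵀ = p.delta := by simp [delta]

theorem neg_Pc_eq :
    -p.Pc = (-p.gam / (2 * (1 - p.gam))) • (p.delta * p.neutral * p.delta) := by
  rw [Pc, neutral, ← neg_smul, neg_div]

theorem neg_Pc_posSemidef (h1 : p.Sigma1.PosDef) (hgam : p.gam < 0)
    (hb : Function.Injective p.beta.mulVec) : (-p.Pc).PosSemidef := by
  rw [neg_Pc_eq]
  have := (p.neutral_posSemidef h1 hb).conjTranspose_mul_mul_same p.delta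
  rw [conjTranspose_eq_transpose_of_trivial, delta_transpose] at this
  refine this.smul ?_
  apply div_nonneg <;> linarith

theorem delta_mulVec_injective (hspeed : ∀ i, p.speed i ≠ 0) {x : Fin d → ℝ}
    (h : p.delta *ᵥ x = 0) : x = 0 := by
  ext i
  have := congrFun h i
  simp only [delta, mulVec_diagonal, Pi.zero_apply, mul_eq_zero, hspeed i, false_or] at this
  simpa using this

theorem neutral_mulVec_delta_of_neg_Pc (hspeed : ∀ i, p.speed i ≠ 0) (hgam : p.gam < 0)
    {x : Fin d → ℝ} (h : (-p.Pc) *ᵥ x = 0) : p.neutral *ᵥ (p.delta *ᵥ x) = 0 := by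
  apply p.delta_mulVec_injective hspeed
  rw [neg_Pc_eq, smul_mulVec, smul_eq_zero] at h
  rcases h with h | h
  · exfalso
    rw [div_eq_zero_iff] at h
    rcases h with h | h <;> linarith
  · rw [mulVec_mulVec, mulVec_mulVec, h]

/-- The hypothesis puts `δ β u` in the range of `β`. The matrix of the rank condition is `δ β`
followed by the projection off that range, so it kills `u`. -/
theorem eq_zero_of_delta_mulVec_eq_beta (h1 : p.Sigma1.PosDef)
    (hrank_delta :
      ((p.delta - p.beta * (p.betaᵀ * p.beta)⁻¹ * p.betaᵀ * p.delta) * p.beta).rank = m)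
    (hrank_beta : (p.betaᵀ * p.beta).rank = m) {u : Fin m → ℝ}
    (h : p.neutral *ᵥ (p.delta *ᵥ (p.beta *ᵥ u)) = 0) : u = 0 := by
  obtain ⟨w, hw⟩ := p.exists_eq_beta_mulVec h1 h
  have hinj := mulVec_injective_of_rank_eq hrank_delta
  have hu : IsUnit (p.betaᵀ * p.beta).det :=
    Matrix.isUnit_iff_isUnit_det _ |>.mp
      (mulVec_injective_iff_isUnit.mp (mulVec_injective_of_rank_eq hrank_beta))
  apply hinj
  simp only [mulVec_zero]
  rw [← mulVec_mulVec, sub_mulVec, ← mulVec_mulVec (p.beta *ᵥ u), hw, mulVec_mulVec]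
  have e : p.beta * (p.betaᵀ * p.beta)⁻¹ * p.betaᵀ * p.beta = p.beta := by
    rw [Matrix.mul_assoc, Matrix.mul_assoc, Matrix.nonsing_inv_mul _ hu, Matrix.mul_one]
  rw [e, sub_self]

theorem isObservable_Ac (h1 : p.Sigma1.PosDef)
    (hspeed : ∀ i, p.speed i ≠ 0) (hgam : p.gam < 0)
    (hrank_delta :
      ((p.delta - p.beta * (p.betaᵀ * p.beta)⁻¹ * p.betaᵀ * p.delta) * p.beta).rank = m)
    (hrank_beta : (p.betaᵀ * p.beta).rank = m) {E : Matrix (Fin d) (Fin d) ℝ}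
    (hE : -p.Pc = Eᵀ * E) : IsObservable E p.Ac := by
  have hker : ∀ x, E *ᵥ x = 0 → p.neutral *ᵥ (p.delta *ᵥ x) = 0 := fun x hx =>
    p.neutral_mulVec_delta_of_neg_Pc hspeed hgam (by rw [hE, ← mulVec_mulVec, hx, mulVec_zero])
  refine isObservable_of_forall_mulVec fun x hx => ?_
  rcases Nat.eq_zero_or_pos d with rfl | hd
  · exact Subsingleton.elim _ _
  have hx0 : E *ᵥ x = 0 := by simpa using hx 0 hd
  have hx1 : E *ᵥ (p.Ac *ᵥ x) = 0 := by
    rw [mulVec_mulVec]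
    -- For `d = 1` the power `k = 1` is outside the range `k < d`, but `1 × 1` matrices commute.
    rcases Nat.lt_or_ge 1 d with h | h
    · simpa using hx 1 h
    · obtain rfl : d = 1 := by omega
      have : E * p.Ac = p.Ac * E := by
        ext i j
        fin_cases i; fin_cases j
        simp [Matrix.mul_apply, mul_comm]
      rw [this, ← mulVec_mulVec, hx0, mulVec_zero]
  have hA : p.Ac *ᵥ x = -(p.delta *ᵥ x) := by
    have e : p.Ac = -((p.gam / (1 - p.gam)) • (p.Sigma2ᵀ * (p.neutral * p.delta))) - p.delta := by
      rw [Ac, neutral, Matrix.mul_assoc]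
    rw [e, sub_mulVec, neg_mulVec, smul_mulVec, ← mulVec_mulVec, ← mulVec_mulVec, hker x hx0]
    simp
  obtain ⟨u, hu⟩ := p.exists_eq_beta_mulVec h1 (hker x hx0)
  have h3 := hker _ hx1
  rw [hA, hu, mulVec_neg, mulVec_neg, neg_eq_zero] at h3
  have := p.eq_zero_of_delta_mulVec_eq_beta h1 hrank_delta hrank_beta h3
  rw [this, mulVec_zero] at hu
  exact p.delta_mulVec_injective hspeed hu

theorem isStabilisable_one (A : Matrix (Fin d) (Fin d) ℝ) : IsStabilisable A (1 : Matrix (Fin d) (Fin d) ℝ) := by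
  refine ⟨A + 1, fun z hz => ?_⟩
  have e : (A - 1 * (A + 1)).map (algebraMap ℝ ℂ) = algebraMap ℂ (Matrix (Fin d) (Fin d) ℂ) (-1) := by
    rw [one_mul, sub_add_cancel_left]
    ext i j
    simp [Matrix.one_apply]
    split_ifs <;> simp
  rw [e] at hz
  rcases subsingleton_or_nontrivial (Matrix (Fin d) (Fin d) ℂ) with h | h
  · rw [spectrum.of_subsingleton] at hz
    exact hz.elim
  · rw [spectrum.scalar_eq, Set.mem_singleton_iff] at hz
    simp [hz]

end CointModel

/-! ### Linear Hamiltonian system -/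

section Flow

attribute [local instance] Matrix.linftyOpNormedRing Matrix.linftyOpNormedAlgebra

variable {n : Type*} [Fintype n]

theorem hasDerivAt_matrix_iff {M : ℝ → Matrix n n ℝ} {M' : Matrix n n ℝ} {s : ℝ} :
    HasDerivAt M M' s ↔ ∀ i j, HasDerivAt (fun t => M t i j) (M' i j) s :=
  hasDerivAt_pi.trans (forall_congr' fun _ => hasDerivAt_pi)

theorem hasDerivWithinAt_matrix_iff {M : ℝ → Matrix n n ℝ} {M' : Matrix n n ℝ} {t : Set ℝ} {s : ℝ} :
    HasDerivWithinAt M M' t s ↔ ∀ i j, HasDerivWithinAt (fun t => M t i j) (M' i j) t s :=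
  hasDerivWithinAt_pi.trans (forall_congr' fun _ => hasDerivWithinAt_pi)

theorem HasDerivAt.matrix_transpose {M : ℝ → Matrix n n ℝ} {M' : Matrix n n ℝ} {s : ℝ}
    (h : HasDerivAt M M' s) : HasDerivAt (fun t => (M t)ᵀ) M'ᵀ s :=
  hasDerivAt_matrix_iff.mpr fun i j => hasDerivAt_matrix_iff.mp h j i

theorem HasDerivAt.matrix_mulVec {M : ℝ → Matrix n n ℝ} {M' : Matrix n n ℝ} {s : ℝ}
    (h : HasDerivAt M M' s) (x : n → ℝ) : HasDerivAt (fun t => M t *ᵥ x) (M' *ᵥ x) s := by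
  refine hasDerivAt_pi.mpr fun i => ?_
  simp only [mulVec, dotProduct]
  exact HasDerivAt.fun_sum fun j _ => (hasDerivAt_matrix_iff.mp h i j).mul_const _

theorem HasDerivAt.matrix_quadForm {M : ℝ → Matrix n n ℝ} {M' : Matrix n n ℝ} {s : ℝ}
    (h : HasDerivAt M M' s) (x : n → ℝ) :
    HasDerivAt (fun t => x ⬝ᵥ (M t *ᵥ x)) (x ⬝ᵥ (M' *ᵥ x)) s := by
  simp only [dotProduct]
  exact HasDerivAt.fun_sum fun j _ => (hasDerivAt_pi.mp (h.matrix_mulVec x) j).const_mul _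

variable [DecidableEq n]

theorem HasDerivAt.matrix_inv {M : ℝ → Matrix n n ℝ} {M' : Matrix n n ℝ} {s : ℝ}
    (h : HasDerivAt M M' s) (hu : IsUnit (M s)) :
    HasDerivAt (fun t => (M t)⁻¹) (-((M s)⁻¹ * M' * (M s)⁻¹)) s := by
  obtain ⟨u, hu⟩ := hu
  have h1 := (hasFDerivAt_ringInverse (𝕜 := ℝ) u)
  rw [hu] at h1
  have h2 := h1.comp_hasDerivAt s h
  have e : (fun t => (M t)⁻¹) = Ring.inverse ∘ M := by
    ext1 t
    exact Matrix.nonsing_inv_eq_ringInverse _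
  rw [e]
  refine h2.congr_deriv ?_
  simp [← hu, Matrix.coe_units_inv]

theorem exists_linear_flow (H : Matrix n n ℝ) :
    ∃ W : ℝ → Matrix n n ℝ, W 0 = 1 ∧ ∀ s, HasDerivAt W (H * W s) s :=
  ⟨fun s => NormedSpace.exp (s • H), by simp, fun s => hasDerivAt_exp_smul_const' H s⟩

/-- A matrix solution of the Hamiltonian system attached to a Riccati equation. -/
structure IsHamiltonianFlow (A Q P : Matrix n n ℝ) (U V : ℝ → Matrix n n ℝ) : Prop where
  init_left : U 0 = 1
  init_right : V 0 = 0
  deriv_left : ∀ s, HasDerivAt U (-(A * U s) + Q * V s) s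
  deriv_right : ∀ s, HasDerivAt V (P * U s + Aᵀ * V s) s

/-- The pair is the first block column of the exponential of `s` times the Hamiltonian block matrix.
-/
theorem exists_isHamiltonianFlow (A Q P : Matrix n n ℝ) :
    ∃ U V : ℝ → Matrix n n ℝ, IsHamiltonianFlow A Q P U V := by
  obtain ⟨W, h0, hW⟩ := exists_linear_flow (fromBlocks (-A) Q P Aᵀ)
  have hent := fun s => hasDerivAt_matrix_iff.mp (hW s)
  have hmul : ∀ s, fromBlocks (-A) Q P Aᵀ * W s =
      fromBlocks (-A * (W s).toBlocks₁₁ + Q * (W s).toBlocks₂₁)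
        (-A * (W s).toBlocks₁₂ + Q * (W s).toBlocks₂₂)
        (P * (W s).toBlocks₁₁ + Aᵀ * (W s).toBlocks₂₁)
        (P * (W s).toBlocks₁₂ + Aᵀ * (W s).toBlocks₂₂) := fun s => by
    rw [← fromBlocks_multiply, fromBlocks_toBlocks]
  refine ⟨fun s => (W s).toBlocks₁₁, fun s => (W s).toBlocks₂₁, ?_, ?_, fun s => ?_, fun s => ?_⟩
  · rw [h0, ← fromBlocks_one, toBlocks_fromBlocks₁₁]
  · rw [h0, ← fromBlocks_one, toBlocks_fromBlocks₂₁]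
  · refine hasDerivAt_matrix_iff.mpr fun i j => ?_
    have := hent s (Sum.inl i) (Sum.inl j)
    rw [hmul, fromBlocks_apply₁₁, neg_mul] at this
    exact this
  · refine hasDerivAt_matrix_iff.mpr fun i j => ?_
    have := hent s (Sum.inr i) (Sum.inl j)
    rw [hmul, fromBlocks_apply₂₁] at this
    exact this

theorem eq_of_hasDerivAt_zero {f : ℝ → Matrix n n ℝ} (h : ∀ s, HasDerivAt f 0 s) (s t : ℝ) :
    f s = f t :=
  is_const_of_deriv_eq_zero (fun s => (h s).differentiableAt) (fun s => (h s).deriv) s t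

namespace IsHamiltonianFlow

variable {A Q P : Matrix n n ℝ} {U V : ℝ → Matrix n n ℝ}

theorem hasDerivAt_pairing (h : IsHamiltonianFlow A Q P U V) (hQ : Qᵀ = Q) (s : ℝ) :
    HasDerivAt (fun s => (U s)ᵀ * V s) ((V s)ᵀ * Q * V s + (U s)ᵀ * P * U s) s := by
  refine ((h.deriv_left s).matrix_transpose.mul (h.deriv_right s)).congr_deriv ?_
  simp only [transpose_add, transpose_neg, transpose_mul, hQ]
  noncomm_ring

/-- The derivative of `Uᵀ V` is symmetric and `Uᵀ V` vanishes at `0`. This is what makes `V U⁻¹`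
symmetric. -/
theorem pairing_transpose (h : IsHamiltonianFlow A Q P U V) (hQ : Qᵀ = Q) (hP : Pᵀ = P) (s : ℝ) :
    (V s)ᵀ * U s = (U s)ᵀ * V s := by
  have h1 : ∀ s, HasDerivAt (fun s => (V s)ᵀ * U s - (U s)ᵀ * V s) 0 s := fun s => by
    have a := (h.hasDerivAt_pairing hQ s)
    have b := a.matrix_transpose
    simp only [transpose_mul, transpose_transpose, transpose_add, hQ, hP] at b
    refine (b.sub a).congr_deriv ?_
    noncomm_ring
  have := eq_of_hasDerivAt_zero h1 s 0
  simp only [h.init_left, h.init_right] at this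
  rw [← sub_eq_zero, this]
  simp

/-- The Hamiltonian of an autonomous system is conserved. For `X = V U⁻¹` this becomes `Uᵀ X' U =
P`. -/
theorem energy (h : IsHamiltonianFlow A Q P U V) (hQ : Qᵀ = Q) (hP : Pᵀ = P) (s : ℝ) :
    (U s)ᵀ * P * U s + (U s)ᵀ * Aᵀ * V s + (V s)ᵀ * A * U s - (V s)ᵀ * Q * V s = P := by
  have h1 : ∀ s, HasDerivAt (fun s => (U s)ᵀ * P * U s + (U s)ᵀ * Aᵀ * V s + (V s)ᵀ * A * U s
      - (V s)ᵀ * Q * V s) 0 s := fun s => by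
    have u := h.deriv_left s
    have v := h.deriv_right s
    have u' := u.matrix_transpose
    have v' := v.matrix_transpose
    have := ((((u'.mul_const P).mul u).add ((u'.mul_const Aᵀ).mul v)).add
      ((v'.mul_const A).mul u)).sub ((v'.mul_const Q).mul v)
    refine this.congr_deriv ?_
    simp only [transpose_add, transpose_neg, transpose_mul, hQ, hP, transpose_transpose]
    noncomm_ring
  have := eq_of_hasDerivAt_zero h1 s 0
  simpa [h.init_left, h.init_right] using this

/-- If `U(s) x = 0`, the form `xᵀ Uᵀ V x` is monotone and vanishes at `0` and `s`, hence is constant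
between. Definiteness of `Q` then gives `V x = 0` there, so `U x` solves `y' = -A y` with `y(s) =
0`; backward uniqueness yields `x = U(0) x = 0`. -/
theorem isUnit_left (h : IsHamiltonianFlow A Q P U V) (hQ : Q.PosDef) (hP : P.PosSemidef)
    {s : ℝ} (hs : 0 ≤ s) : IsUnit (U s) := by
  rw [← mulVec_injective_iff_isUnit]
  refine (injective_iff_map_eq_zero (U s).mulVecLin).mpr fun x hx => ?_
  simp only [mulVecLin_apply] at hx
  have hQt : Qᵀ = Q := by simpa using hQ.isHermitian.eq
  have hq : ∀ r, HasDerivAt (fun r => x ⬝ᵥ (((U r)ᵀ * V r) *ᵥ x))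
      ((V r *ᵥ x) ⬝ᵥ (Q *ᵥ (V r *ᵥ x)) + (U r *ᵥ x) ⬝ᵥ (P *ᵥ (U r *ᵥ x))) r := fun r => by
    refine ((h.hasDerivAt_pairing hQt r).matrix_quadForm x).congr_deriv ?_
    simp only [add_mulVec, dotProduct_add, ← mulVec_mulVec, mulVec_transpose]
    simp only [dotProduct_comm x, ← dotProduct_mulVec]
    simp only [dotProduct_comm]
  have hQn : ∀ y : n → ℝ, 0 ≤ y ⬝ᵥ (Q *ᵥ y) := fun y => by
    simpa using hQ.posSemidef.dotProduct_mulVec_nonneg y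
  have hPn : ∀ y : n → ℝ, 0 ≤ y ⬝ᵥ (P *ᵥ y) := fun y => by
    simpa using hP.dotProduct_mulVec_nonneg y
  have hmono : Monotone (fun r => x ⬝ᵥ (((U r)ᵀ * V r) *ᵥ x)) :=
    monotone_of_hasDerivAt_nonneg hq fun r => add_nonneg (hQn _) (hPn _)
  have e0 : x ⬝ᵥ (((U 0)ᵀ * V 0) *ᵥ x) = 0 := by simp [h.init_right]
  have es : x ⬝ᵥ (((U s)ᵀ * V s) *ᵥ x) = 0 := by
    rw [← mulVec_mulVec, mulVec_transpose, dotProduct_comm, ← dotProduct_mulVec, hx,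
      dotProduct_zero]
  have hV : ∀ r ∈ Ioo 0 s, V r *ᵥ x = 0 := fun r hr => by
    have hloc : (fun r => x ⬝ᵥ (((U r)ᵀ * V r) *ᵥ x)) =ᶠ[𝓝 r] fun _ => 0 := by
      filter_upwards [Ioo_mem_nhds hr.1 hr.2] with t ht
      have a := hmono ht.1.le
      have b := hmono ht.2.le
      simp only [e0, es] at a b
      exact le_antisymm b a
    have hz := (hq r).unique ((hasDerivAt_const r (0 : ℝ)).congr_of_eventuallyEq hloc)
    by_contra hne
    have := hQ.dotProduct_mulVec_pos hne
    simp only [star_trivial] at this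
    linarith [hPn (U r *ᵥ x)]
  have hU : ∀ r, HasDerivAt (fun r => U r *ᵥ x) (-(A *ᵥ (U r *ᵥ x)) + Q *ᵥ (V r *ᵥ x)) r :=
    fun r => by
      refine ((h.deriv_left r).matrix_mulVec x).congr_deriv ?_
      simp [add_mulVec, neg_mulVec, mulVec_mulVec]
  let L : (n → ℝ) →L[ℝ] (n → ℝ) := -(LinearMap.toContinuousLinearMap A.mulVecLin)
  have hcont : Continuous (fun r => U r *ᵥ x) :=
    continuous_iff_continuousAt.mpr fun r => (hU r).continuousAt
  have hVc : Continuous (fun r => V r *ᵥ x) :=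
    continuous_iff_continuousAt.mpr fun r => ((h.deriv_right r).matrix_mulVec x).continuousAt
  rcases hs.eq_or_lt with rfl | hs
  · simpa [h.init_left] using hx
  have hV' : ∀ r ∈ Icc 0 s, V r *ᵥ x = 0 := by
    rw [← closure_Ioo hs.ne]
    exact closure_minimal hV (isClosed_eq hVc continuous_const)
  have huniq := ODE_solution_unique_of_mem_Icc_left (E := n → ℝ) (a := 0) (b := s)
    (v := fun _ y => L y) (s := fun _ => univ) (K := ‖L‖₊)
    (f := fun r => U r *ᵥ x) (g := fun _ => 0)
    (fun _ _ => L.lipschitz.lipschitzOnWith) hcont.continuousOn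
    (fun r hr => ((hU r).congr_deriv (by
      simp [L, hV' r ⟨hr.1.le, hr.2⟩])).hasDerivWithinAt)
    (fun _ _ => trivial) continuousOn_const
    (fun r _ => (hasDerivWithinAt_const r _ (0 : n → ℝ)).congr_deriv (by simp))
    (fun _ _ => trivial) hx
  have := huniq (left_mem_Icc.mpr hs.le)
  simpa [h.init_left] using this

end IsHamiltonianFlow

end Flow

/-! ### Riccati equation: uniqueness, monotonicity, bounds and limit -/

section Riccati

attribute [local instance] Matrix.linftyOpNormedRing Matrix.linftyOpNormedAlgebra

/-- The quadratic field is Lipschitz on balls, and both solutions stay in one ball over the compact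
interval `[t, T]`. -/
theorem riccati_solution_unique {R : Type*} [NormedRing R] [NormedAlgebra ℝ R] (Q A A' P : R)
    {T : ℝ} {F G : ℝ → R}
    (hF : ∀ t ≤ T, HasDerivWithinAt F (-(F t * Q * F t) - F t * A - A' * F t - P) (Iic T) t)
    (hG : ∀ t ≤ T, HasDerivWithinAt G (-(G t * Q * G t) - G t * A - A' * G t - P) (Iic T) t)
    (hT : F T = G T) {t : ℝ} (ht : t ≤ T) : F t = G t := by
  have cF : ContinuousOn F (Icc t T) := fun s hs =>
    (hF s hs.2).continuousWithinAt.mono Icc_subset_Iic_self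
  have cG : ContinuousOn G (Icc t T) := fun s hs =>
    (hG s hs.2).continuousWithinAt.mono Icc_subset_Iic_self
  obtain ⟨M₁, h₁⟩ := isCompact_Icc.exists_bound_of_continuousOn cF
  obtain ⟨M₂, h₂⟩ := isCompact_Icc.exists_bound_of_continuousOn cG
  set M := max M₁ M₂
  have hM : 0 ≤ M := (norm_nonneg _).trans ((h₁ t (left_mem_Icc.mpr ht)).trans (le_max_left _ _))
  have hK : 0 ≤ ‖Q‖ * M + M * ‖Q‖ + ‖A‖ + ‖A'‖ := by positivity
  refine ODE_solution_unique_of_mem_Icc_left (a := t) (b := T)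
    (v := fun _ y => -(y * Q * y) - y * A - A' * y - P) (s := fun _ => Metric.closedBall 0 M)
    (K := ⟨_, hK⟩) (fun _ _ => LipschitzOnWith.of_dist_le_mul fun y hy z hz => ?_) cF
    (fun s hs => (hF s hs.2).mono (Iic_subset_Iic.mpr hs.2)) (fun s hs => ?_) cG
    (fun s hs => (hG s hs.2).mono (Iic_subset_Iic.mpr hs.2)) (fun s hs => ?_) hT
    (left_mem_Icc.mpr ht)
  · rw [mem_closedBall_zero_iff] at hy hz
    rw [dist_eq_norm, dist_eq_norm]
    have e : -(y * Q * y) - y * A - A' * y - P - (-(z * Q * z) - z * A - A' * z - P) =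
        -((y - z) * (Q * y) + z * Q * (y - z) + (y - z) * A + A' * (y - z)) := by noncomm_ring
    rw [e, norm_neg]
    have b1 : ‖(y - z) * (Q * y)‖ ≤ ‖y - z‖ * (‖Q‖ * M) :=
      (norm_mul_le _ _).trans (by gcongr; exact (norm_mul_le _ _).trans (by gcongr))
    have b2 : ‖z * Q * (y - z)‖ ≤ M * ‖Q‖ * ‖y - z‖ :=
      (norm_mul_le _ _).trans (by gcongr; exact (norm_mul_le _ _).trans (by gcongr))
    have b3 := norm_mul_le (y - z) A
    have b4 := norm_mul_le A' (y - z)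
    have b := norm_add₄_le (a := (y - z) * (Q * y)) (b := z * Q * (y - z)) (c := (y - z) * A)
      (d := A' * (y - z))
    change _ ≤ (‖Q‖ * M + M * ‖Q‖ + ‖A‖ + ‖A'‖) * ‖y - z‖
    linarith
  · exact mem_closedBall_zero_iff.mpr ((h₁ s (Ioc_subset_Icc_self hs)).trans (le_max_left _ _))
  · exact mem_closedBall_zero_iff.mpr ((h₂ s (Ioc_subset_Icc_self hs)).trans (le_max_right _ _))

variable {n : Type*} [Fintype n] [DecidableEq n]

open scoped MatrixOrder in
theorem Matrix.PosSemidef.exists_eq_transpose_mul_self {M : Matrix n n ℝ} (hM : M.PosSemidef) :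
    ∃ E : Matrix n n ℝ, M = Eᵀ * E := by
  obtain ⟨E, hE⟩ := CStarAlgebra.nonneg_iff_eq_star_mul_self.mp hM.nonneg
  exact ⟨E, by rw [hE, star_eq_conjTranspose, conjTranspose_eq_transpose_of_trivial]⟩

/-- The form is nonnegative at `y ± w` with `w = Q⁻¹ eᵢ`; the cross terms are `± 2 yᵢ`. -/
theorem Matrix.PosDef.two_mul_abs_apply_le {Q : Matrix n n ℝ} (hQ : Q.PosDef) (y : n → ℝ) (i : n) :
    2 * |y i| ≤ y ⬝ᵥ (Q *ᵥ y) + Q⁻¹ i i := by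
  have hu := Matrix.isUnit_iff_isUnit_det _ |>.mp hQ.isUnit
  have hQt : Qᵀ = Q := by simpa using hQ.isHermitian.eq
  set w := Q⁻¹ *ᵥ Pi.single i 1
  have hw : Q *ᵥ w = Pi.single i 1 := by
    simp only [w]
    rw [mulVec_mulVec, Matrix.mul_nonsing_inv _ hu, one_mulVec]
  have hwi : w i = Q⁻¹ i i := by simp [w]
  have hsym : w ⬝ᵥ (Q *ᵥ y) = y i := by
    rw [dotProduct_mulVec, ← mulVec_transpose, hQt, hw, single_dotProduct, one_mul]
  have h1 : 0 ≤ (y - w) ⬝ᵥ (Q *ᵥ (y - w)) := by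
    simpa using hQ.posSemidef.dotProduct_mulVec_nonneg (y - w)
  have h2 : 0 ≤ (y + w) ⬝ᵥ (Q *ᵥ (y + w)) := by
    simpa using hQ.posSemidef.dotProduct_mulVec_nonneg (y + w)
  simp only [mulVec_sub, mulVec_add, dotProduct_sub, sub_dotProduct, dotProduct_add, add_dotProduct,
    hw, hsym, dotProduct_single, mul_one, Pi.sub_apply, Pi.add_apply, hwi] at h1 h2
  rcases abs_cases (y i) with h | h <;> linarith [h.1]

/-- A sublevel set of a positive definite inhomogeneous quadratic form is bounded. -/
theorem Matrix.PosDef.exists_bound {Q : Matrix n n ℝ} (hQ : Q.PosDef) (a : n → ℝ) (c : ℝ) :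
    ∃ K, ∀ y : n → ℝ, y ⬝ᵥ (Q *ᵥ y) ≤ 2 * (y ⬝ᵥ a) + c → ∀ i, |y i| ≤ K := by
  have hu := Matrix.isUnit_iff_isUnit_det _ |>.mp hQ.isUnit
  have hQt : Qᵀ = Q := by simpa using hQ.isHermitian.eq
  -- Centre of the quadratic: completing the square bounds the form at `y - b` by `c + a ⬝ᵥ b`.
  set b := Q⁻¹ *ᵥ a
  have hb : Q *ᵥ b = a := by
    simp only [b]
    rw [mulVec_mulVec, Matrix.mul_nonsing_inv _ hu, one_mulVec]
  refine ⟨∑ i, (|c + a ⬝ᵥ b + Q⁻¹ i i| + |b i|), fun y hy i => ?_⟩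
  have h1 := hQ.two_mul_abs_apply_le (y - b) i
  have hsym : b ⬝ᵥ (Q *ᵥ y) = y ⬝ᵥ a := by
    rw [dotProduct_mulVec, ← mulVec_transpose, hQt, hb, dotProduct_comm]
  simp only [mulVec_sub, dotProduct_sub, sub_dotProduct, hb, hsym, Pi.sub_apply] at h1
  rw [dotProduct_comm b a] at h1
  have h2 : |y i| ≤ |y i - b i| + |b i| := by
    simpa using abs_add_le (y i - b i) (b i)
  have h3 := le_abs_self (c + a ⬝ᵥ b + Q⁻¹ i i)
  have h4 := Finset.single_le_sum (f := fun i => |c + a ⬝ᵥ b + Q⁻¹ i i| + |b i|)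
    (fun i _ => by positivity) (Finset.mem_univ i)
  beta_reduce at h4
  linarith [abs_nonneg (y i - b i)]

/-- Polarization of the quadratic form of a symmetric matrix. -/
theorem Matrix.IsHermitian.apply_eq_polarization {X : Matrix n n ℝ} (hX : X.IsHermitian) (i j : n) :
    X i j = ((Pi.single i 1 + Pi.single j 1) ⬝ᵥ (X *ᵥ (Pi.single i 1 + Pi.single j 1)) -
      Pi.single i 1 ⬝ᵥ (X *ᵥ Pi.single i 1) - Pi.single j 1 ⬝ᵥ (X *ᵥ Pi.single j 1)) / 2 := by
  have : X j i = X i j := by simpa using hX.apply i j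
  simp [mulVec_add, this]
  ring

namespace IsHamiltonianFlow

variable {A Q P : Matrix n n ℝ} {U V : ℝ → Matrix n n ℝ}

theorem quotient_isHermitian (h : IsHamiltonianFlow A Q P U V) (hQ : Q.PosDef)
    (hP : P.PosSemidef) {s : ℝ} (hs : 0 ≤ s) : (V s * (U s)⁻¹).IsHermitian := by
  have hu := Matrix.isUnit_iff_isUnit_det _ |>.mp (h.isUnit_left hQ hP hs)
  have hQt : Qᵀ = Q := by simpa using hQ.isHermitian.eq
  have hPt : Pᵀ = P := by simpa using hP.isHermitian.eq
  have hut : IsUnit (U s)ᵀ.det := by rwa [det_transpose]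
  have e := h.pairing_transpose hQt hPt s
  rw [IsHermitian, conjTranspose_eq_transpose_of_trivial, transpose_mul, transpose_nonsing_inv]
  calc (U s)ᵀ⁻¹ * (V s)ᵀ = (U s)ᵀ⁻¹ * ((V s)ᵀ * U s) * (U s)⁻¹ := by
        rw [Matrix.mul_assoc, Matrix.mul_assoc, Matrix.mul_nonsing_inv _ hu, Matrix.mul_one]
    _ = V s * (U s)⁻¹ := by rw [e, Matrix.nonsing_inv_mul_cancel_left _ _ hut]

theorem hasDerivAt_quotient (h : IsHamiltonianFlow A Q P U V) (hQ : Q.PosDef)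
    (hP : P.PosSemidef) {s : ℝ} (hs : 0 ≤ s) :
    HasDerivAt (fun s => V s * (U s)⁻¹)
      (P + Aᵀ * (V s * (U s)⁻¹) + V s * (U s)⁻¹ * A - V s * (U s)⁻¹ * Q * (V s * (U s)⁻¹)) s := by
  have hu := h.isUnit_left hQ hP hs
  have hu' := Matrix.mul_nonsing_inv _ (Matrix.isUnit_iff_isUnit_det _ |>.mp hu)
  refine ((h.deriv_right s).mul ((h.deriv_left s).matrix_inv hu)).congr_deriv ?_
  have e1 : (P * U s + Aᵀ * V s) * (U s)⁻¹ = P * (U s * (U s)⁻¹) + Aᵀ * (V s * (U s)⁻¹) := by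
    noncomm_ring
  have e2 : V s * -((U s)⁻¹ * (-(A * U s) + Q * V s) * (U s)⁻¹) =
      V s * (U s)⁻¹ * A * (U s * (U s)⁻¹) - V s * (U s)⁻¹ * Q * (V s * (U s)⁻¹) := by
    noncomm_ring
  rw [e1, e2, hu', Matrix.mul_one, Matrix.mul_one]
  abel

/-- Congruence by the invertible `U` turns this into the conserved energy, which is `P`. -/
theorem deriv_quotient_posSemidef (h : IsHamiltonianFlow A Q P U V) (hQ : Q.PosDef)
    (hP : P.PosSemidef) {s : ℝ} (hs : 0 ≤ s) :
    (P + Aᵀ * (V s * (U s)⁻¹) + V s * (U s)⁻¹ * A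
      - V s * (U s)⁻¹ * Q * (V s * (U s)⁻¹)).PosSemidef := by
  have hu := h.isUnit_left hQ hP hs
  have hQt : Qᵀ = Q := by simpa using hQ.isHermitian.eq
  have hPt : Pᵀ = P := by simpa using hP.isHermitian.eq
  rw [← hu.posSemidef_star_left_conjugate_iff]
  have hX := h.quotient_isHermitian hQ hP hs
  set X := V s * (U s)⁻¹ with hXdef
  have e1 : X * U s = V s := by
    rw [hXdef, Matrix.nonsing_inv_mul_cancel_right _ _ (Matrix.isUnit_iff_isUnit_det _ |>.mp hu)]
  have e2 : (U s)ᵀ * X = (V s)ᵀ := by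
    rw [← e1, transpose_mul, ← conjTranspose_eq_transpose_of_trivial X, hX.eq]
  have e3 : star (U s) * (P + Aᵀ * X + X * A - X * Q * X) * U s = (U s)ᵀ * P * U s +
      (U s)ᵀ * Aᵀ * (X * U s) + (U s)ᵀ * X * A * U s - (U s)ᵀ * X * Q * (X * U s) := by
    rw [star_eq_conjTranspose, conjTranspose_eq_transpose_of_trivial]
    noncomm_ring
  rw [e3, e1, e2, h.energy hQt hPt]
  exact hP

theorem quadForm_monotoneOn (h : IsHamiltonianFlow A Q P U V) (hQ : Q.PosDef)
    (hP : P.PosSemidef) (x : n → ℝ) :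
    MonotoneOn (fun s => x ⬝ᵥ ((V s * (U s)⁻¹) *ᵥ x)) (Ici 0) := by
  have hd : ∀ s, 0 ≤ s → HasDerivAt (fun s => x ⬝ᵥ ((V s * (U s)⁻¹) *ᵥ x)) _ s :=
    fun s hs => (h.hasDerivAt_quotient hQ hP hs).matrix_quadForm x
  refine monotoneOn_of_hasDerivWithinAt_nonneg (convex_Ici 0)
    (fun s hs => (hd s hs).continuousAt.continuousWithinAt)
    (fun s hs => (hd s (interior_subset hs)).hasDerivWithinAt) fun s hs => ?_
  simpa using (h.deriv_quotient_posSemidef hQ hP (interior_subset hs)).dotProduct_mulVec_nonneg x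

theorem quotient_posSemidef (h : IsHamiltonianFlow A Q P U V) (hQ : Q.PosDef)
    (hP : P.PosSemidef) {s : ℝ} (hs : 0 ≤ s) : (V s * (U s)⁻¹).PosSemidef := by
  refine .of_dotProduct_mulVec_nonneg (h.quotient_isHermitian hQ hP hs) fun x => ?_
  have := h.quadForm_monotoneOn hQ hP x self_mem_Ici hs hs
  simpa [h.init_right] using this

/-- Testing `X' ≥ 0` on `eⱼ`, the column `y = X eⱼ` satisfies `yᵀ Q y ≤ 2 yᵀ A eⱼ + Pⱼⱼ`, a bounded
set independent of `s`. -/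
theorem exists_quotient_bound (h : IsHamiltonianFlow A Q P U V) (hQ : Q.PosDef)
    (hP : P.PosSemidef) : ∃ K, ∀ s, 0 ≤ s → ∀ i j, |(V s * (U s)⁻¹) i j| ≤ K := by
  choose K hK using fun j : n => hQ.exists_bound (A *ᵥ Pi.single j 1) (P j j)
  refine ⟨∑ j, |K j|, fun s hs i j => ?_⟩
  have hX := h.quotient_isHermitian hQ hP hs
  have hR := (h.deriv_quotient_posSemidef hQ hP hs).dotProduct_mulVec_nonneg (Pi.single j 1)
  set X := V s * (U s)⁻¹
  have hXt : Xᵀ = X := by simpa using hX.eq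
  have hv : ∀ v, Pi.single j 1 ⬝ᵥ (X *ᵥ v) = (X *ᵥ Pi.single j 1) ⬝ᵥ v := fun v => by
    rw [dotProduct_mulVec, ← mulVec_transpose, hXt]
  have hv' : Pi.single j 1 ⬝ᵥ (Aᵀ *ᵥ (X *ᵥ Pi.single j 1)) =
      (X *ᵥ Pi.single j 1) ⬝ᵥ (A *ᵥ Pi.single j 1) := by
    rw [dotProduct_mulVec, vecMul_transpose, dotProduct_comm]
  simp only [star_trivial, sub_mulVec, add_mulVec, dotProduct_sub, dotProduct_add,
    ← mulVec_mulVec, hv, hv'] at hR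
  have hPj : Pi.single j 1 ⬝ᵥ (P *ᵥ Pi.single j 1) = P j j := by simp
  rw [hPj] at hR
  have := hK j (X *ᵥ Pi.single j 1) (by linarith) i
  have e : (X *ᵥ Pi.single j 1) i = X i j := by simp
  rw [e] at this
  exact this.trans ((le_abs_self _).trans
    (Finset.single_le_sum (f := fun j => |K j|) (fun _ _ => abs_nonneg _) (Finset.mem_univ j)))

theorem exists_tendsto_quotient (h : IsHamiltonianFlow A Q P U V) (hQ : Q.PosDef)
    (hP : P.PosSemidef) : ∃ L, Tendsto (fun s => V s * (U s)⁻¹) atTop (𝓝 L) := by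
  obtain ⟨K, hK⟩ := h.exists_quotient_bound hQ hP
  have hq : ∀ x : n → ℝ, ∃ l, Tendsto (fun s => x ⬝ᵥ ((V s * (U s)⁻¹) *ᵥ x)) atTop (𝓝 l) := by
    intro x
    -- Freezing time at `0` for negative `s` makes the form monotone on the whole line.
    have hm : Monotone fun s => x ⬝ᵥ ((V (max s 0) * (U (max s 0))⁻¹) *ᵥ x) := fun a b hab =>
      h.quadForm_monotoneOn hQ hP x (le_max_right a 0) (le_max_right b 0)
        (max_le_max_right 0 hab)
    have hb : BddAbove (range fun s => x ⬝ᵥ ((V (max s 0) * (U (max s 0))⁻¹) *ᵥ x)) := by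
      refine ⟨∑ i, |x i| * ∑ j, K * |x j|, ?_⟩
      rintro _ ⟨s, rfl⟩
      simp only [dotProduct, mulVec]
      refine Finset.sum_le_sum fun i _ => (le_abs_self _).trans ?_
      rw [abs_mul]
      refine mul_le_mul_of_nonneg_left ((Finset.abs_sum_le_sum_abs _ _).trans
        (Finset.sum_le_sum fun j _ => ?_)) (abs_nonneg _)
      rw [abs_mul]
      exact mul_le_mul_of_nonneg_right (hK _ (le_max_right s 0) i j) (abs_nonneg _)
    refine ⟨_, (tendsto_atTop_ciSup hm hb).congr' ?_⟩
    filter_upwards [eventually_ge_atTop 0] with s hs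
    rw [max_eq_left hs]
  choose l hl using hq
  refine ⟨Matrix.of fun i j => (l (Pi.single i 1 + Pi.single j 1) - l (Pi.single i 1)
    - l (Pi.single j 1)) / 2, ?_⟩
  refine tendsto_pi_nhds.mpr fun i => tendsto_pi_nhds.mpr fun j => ?_
  refine ((((hl _).sub (hl _)).sub (hl _)).div_const 2).congr' ?_
  filter_upwards [eventually_ge_atTop 0] with s hs
  exact ((h.quotient_isHermitian hQ hP hs).apply_eq_polarization i j).symm

end IsHamiltonianFlow

end Riccati

/-! ### Return to the model by time reversal -/

namespace CointModel

variable {d m : ℕ} (p : CointModel d m)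

theorem isRiccatiSolution_iff {T : ℝ} {C : ℝ → Matrix (Fin d) (Fin d) ℝ} :
    p.IsRiccatiSolution T C ↔ (∀ t ≤ T, HasDerivWithinAt C
      (-(C t * p.Qc * C t) - C t * p.Ac - p.Acᵀ * C t - p.Pc) (Iic T) t) ∧ C T = 0 :=
  and_congr_left fun _ => forall₂_congr fun _ _ => hasDerivWithinAt_matrix_iff.symm

theorem isRiccatiSolution_unique {T : ℝ} {C C' : ℝ → Matrix (Fin d) (Fin d) ℝ}
    (h : p.IsRiccatiSolution T C) (h' : p.IsRiccatiSolution T C') {t : ℝ} (ht : t ≤ T) :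
    C' t = C t := by
  rw [isRiccatiSolution_iff] at h h'
  let _ := Matrix.linftyOpNormedRing (n := Fin d) (α := ℝ)
  let _ := Matrix.linftyOpNormedAlgebra (n := Fin d) (R := ℝ) (α := ℝ)
  exact riccati_solution_unique p.Qc p.Ac p.Acᵀ p.Pc h'.1 h.1 (h'.2.trans h.2.symm) ht

theorem exists_isRiccatiSolution (T : ℝ) (hQ : p.Qc.PosDef) (hP : (-p.Pc).PosSemidef) :
    ∃ C : ℝ → Matrix (Fin d) (Fin d) ℝ,
      p.IsRiccatiSolution T C ∧
      (∀ t ≤ T, (-(C t)).PosSemidef) ∧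
      (∃ K : ℝ, ∀ t ≤ T, ∀ i j, |C t i j| ≤ K) ∧
      ∃ Cbar : Matrix (Fin d) (Fin d) ℝ, Tendsto C atBot (𝓝 Cbar) := by
  obtain ⟨U, V, h⟩ := exists_isHamiltonianFlow p.Ac p.Qc (-p.Pc)
  refine ⟨fun t => -(V (T - t) * (U (T - t))⁻¹), ?_, fun t ht => ?_, ?_, ?_⟩
  · rw [isRiccatiSolution_iff]
    refine ⟨fun t ht => ?_, by simp [h.init_right]⟩
    have h1 := h.hasDerivAt_quotient hQ hP (sub_nonneg.mpr ht)
    have h2 : HasDerivAt (fun t => T - t) (-1) t := by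
      simpa using (hasDerivAt_id t).const_sub T
    rw [hasDerivWithinAt_matrix_iff]
    intro i j
    have h3 := ((hasDerivAt_matrix_iff.mp h1 i j).comp t h2).neg.hasDerivWithinAt (s := Iic T)
    refine h3.congr_deriv ?_
    rw [mul_neg_one, neg_neg]
    refine congrFun (congrFun (?_ : (_ : Matrix (Fin d) (Fin d) ℝ) = _) i) j
    simp only [neg_mul, mul_neg, neg_neg, Matrix.mul_assoc]
    abel
  · rw [neg_neg]
    exact h.quotient_posSemidef hQ hP (sub_nonneg.mpr ht)
  · obtain ⟨K, hK⟩ := h.exists_quotient_bound hQ hP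
    refine ⟨K, fun t ht i j => ?_⟩
    refine (abs_neg _).trans_le ?_
    exact hK _ (sub_nonneg.mpr ht) i j
  · obtain ⟨L, hL⟩ := h.exists_tendsto_quotient hQ hP
    exact ⟨-L, (hL.comp (tendsto_atTop_add_const_left _ T tendsto_neg_atBot_atTop)).neg⟩

end CointModel

theorem mainTheorem2 {d m : ℕ} (p : CointModel d m) (T : ℝ)
    (hS0 : p.Sigma0.PosDef) (hS1 : p.Sigma1.PosDef) (hS3 : p.Sigma3.PosDef)
    (hspeed : ∀ i, p.speed i ≠ 0)
    (hgam : p.gam < 0)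
    (hrank_delta :
      ((p.delta - p.beta * (p.betaᵀ * p.beta)⁻¹ * p.betaᵀ * p.delta) * p.beta).rank = m)
    (hrank_beta : (p.betaᵀ * p.beta).rank = m) :
    p.Qc.PosDef ∧ (-p.Pc).PosSemidef ∧
    (∃ B N E : Matrix (Fin d) (Fin d) ℝ,
      N.PosDef ∧ p.Qc = B * N⁻¹ * Bᵀ ∧ -p.Pc = Eᵀ * E ∧
      IsStabilisable p.Ac B ∧ IsObservable E p.Ac) ∧
    (∃ C : ℝ → Matrix (Fin d) (Fin d) ℝ,
      p.IsRiccatiSolution T C ∧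
      (∀ t ≤ T, (-(C t)).PosSemidef) ∧
      (∃ K : ℝ, ∀ t ≤ T, ∀ i j, |C t i j| ≤ K) ∧
      (∀ C' : ℝ → Matrix (Fin d) (Fin d) ℝ,
        p.IsRiccatiSolution T C' → ∀ t ≤ T, C' t = C t) ∧
      ∃! Cbar : Matrix (Fin d) (Fin d) ℝ, Tendsto C atBot (𝓝 Cbar)) := by
  have hb : Function.Injective p.beta.mulVec := by
    rw [rank_transpose_mul_self] at hrank_beta
    exact mulVec_injective_of_rank_eq hrank_beta
  have hQ := p.Qc_posDef hS0 hS1 hS3 hgam hb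
  have hP := p.neg_Pc_posSemidef hS1 hgam hb
  refine ⟨hQ, hP, ?_, ?_⟩
  · obtain ⟨E, hE⟩ := hP.exists_eq_transpose_mul_self
    -- `B = 1` forces `N = Q_c⁻¹`, and stabilisability is immediate: `M = A + 1` gives `A - M = -1`.
    exact ⟨1, p.Qc⁻¹, E, hQ.inv, by
      rw [Matrix.nonsing_inv_nonsing_inv _ (Matrix.isUnit_iff_isUnit_det _ |>.mp hQ.isUnit)]; simp,
      hE, CointModel.isStabilisable_one _,
      p.isObservable_Ac hS1 hspeed hgam hrank_delta hrank_beta hE⟩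
  · obtain ⟨C, hC, hneg, hbdd, L, hL⟩ := p.exists_isRiccatiSolution T hQ hP
    exact ⟨C, hC, hneg, hbdd, fun C' hC' t ht => p.isRiccatiSolution_unique hC hC' ht,
      L, hL, fun L' hL' => tendsto_nhds_unique hL' hL⟩
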